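/- Let $\phi=\phi_{\mathbb{Z}[i]}$ be the minimal Euclidean function of $\mathbb{Z}[i]$, i.e. the pointwise minimum of all Euclidean functions on $\mathbb{Z}[i]\setminus\{0\}$, where a function $f$ from $\mathbb{Z}[i]\setminus\{0\}$ to a well-ordered set is Euclidean if for all nonzero $a,b$ there are $q,r$ with $a=qb+r$ and $r=0$ or $f(r)<f(b)$. For $z=x+yi\in\mathbb{Z}[i]$ put $\ell_\infty(z)=\max(|x|,|y|)$ and $m(z)=\min(|x|,|y|)$; for $z\neq 0$ let $v_2(z)$ be the largest $c$ with $2^c\mid z$, let $u_z$ be the unique unit of $\mathbb{Z}[i]$ such that $\Re(u_z z)=\ell_\infty(z)$ if $\ell_\infty(z)\ne m(z)$ and $u_z z=\ell_\infty(z)(1+i)$ if $\ell_\infty(z)=m(z)$, and let $s(z)\in\{-1,0,1\}$ be the sign of $\Im(u_z z)$. Put $w_{2k}=3\cdot 2^k$ and $w_{2k+1}=4\cdot 2^k$ for $k\ge 0$. For $a,b\in\mathbb{Z}[i]\setminus\{0\}$, the Gauss quotient $q$ of $a$ and $b$ is obtained by rounding the real and imaginary parts of $a/b$ to nearest integers (halves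 are rounded down), and the Gauss remainder is $r=a-qb$. Theorem. Suppose $a,b\in\mathbb{Z}[i]\setminus\{0\}$ have Gauss quotient $q$ and nonzero Gauss remainder $r$ with $\phi(r)\ge\phi(b)=n$. If any of the following conditions holds: 1. $\Im(u_b b)\,\Im(u_r r)\ge 0$, 2. $m(r)+m(b)\le \ell_\infty(r)$, 3. $m(b)<\ell_\infty(r)<m(b)+m(r)$ and $\ell_\infty(b)-m(r)>w_{n-1}-2^{v_2(b)+1}$, then $a=\left(q+\frac{u_b}{u_r}\right)b+\left(r-\frac{u_b}{u_r}b\right)$, where $r-\frac{u_b}{u_r}b\ne 0$ and $\phi\left(r-\frac{u_b}{u_r}b\right)<\phi(b)$. Otherwise, $s(r)\neq 0$ and $a=\left(q+\frac{i u_b}{s(r)u_r}\right)b+\left(r-\frac{i u_b}{s(r)u_r}b\right)$, where $r-\frac{i u_b}{s(r)u_r}b\ne 0$ and $\phi\left(r-\frac{i u_b}{s(r)u_r}b\right)<\phi(b)$. -/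

import Mathlib

/-- `f` is a Euclidean function on `R ∖ {0}` with values in `W`: for all nonzero `a`, `b` there are
`q`, `r` with `a = q * b + r` and `r = 0` or `f r < f b`. The value `f 0` plays no role. -/
def IsEuclideanFunction {R : Type*} [CommRing R] {W : Type*} [LT W] (f : R → W) : Prop :=
  ∀ a b : R, a ≠ 0 → b ≠ 0 → ∃ q r : R, a = q * b + r ∧ (r = 0 ∨ f r < f b)

/-- The minimal Euclidean function `φ_R` of `R`: the pointwise minimum of all Euclidean functions
on `R ∖ {0}`. Every well-ordered set is order isomorphic to an initial segment of the ordinals, so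
the functions are taken to be ordinal valued. The value at `0` is meaningless (and so are all
values if `R` has no Euclidean function). -/
noncomputable def minEuclid.{u} {R : Type u} [CommRing R] (x : R) : Ordinal.{u} :=
  sInf {α : Ordinal.{u} | ∃ f : R → Ordinal.{u}, IsEuclideanFunction f ∧ f x = α}

namespace GaussDiv

/-- The sequence `w_{2k} = 3 * 2 ^ k`, `w_{2k+1} = 4 * 2 ^ k` for indices `m ≥ 0`. (It is used at
`n - 1` for `n = φ(b)`, where `b` is not a unit because it has a nonzero remainder, so `n ≥ 1`.) -/
def w (m : ℕ) : ℤ := if Even m then 3 * 2 ^ (m / 2) else 4 * 2 ^ (m / 2)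

/-- The imaginary unit of `ℤ[i]`. -/
def I : GaussianInt := ⟨0, 1⟩

/-- The norm `ℓ_∞(x + y i) = max (|x|, |y|)`. -/
def lInf (z : GaussianInt) : ℤ := max |z.re| |z.im|

/-- The norm `ℓ_1(x + y i) = |x| + |y|`. -/
def lOne (z : GaussianInt) : ℤ := |z.re| + |z.im|

/-- `m(z) = ℓ_1(z) - ℓ_∞(z)`, which is `min (|x|, |y|)`. -/
def m (z : GaussianInt) : ℤ := lOne z - lInf z

/-- The `2`-adic valuation `v_2(z)` in `ℤ[i]`: for `z ≠ 0` it is the `c` with `2 ^ c ∣ z` and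
`¬ 2 ^ (c + 1) ∣ z`. -/
noncomputable def v2 (z : GaussianInt) : ℕ := multiplicity (2 : GaussianInt) z

/-- The property that singles out the unit `u_z`. -/
def IsTurn (z : GaussianInt) (u : GaussianIntˣ) : Prop :=
  (lInf z ≠ m z → ((u : GaussianInt) * z).re = lInf z) ∧
  (lInf z = m z → (u : GaussianInt) * z = (lInf z : GaussianInt) * (1 + I))

set_option maxHeartbeats 2000000 in
/-- Every nonzero `z` has exactly one unit `u_z`. -/
theorem existsUnique_isTurn {z : GaussianInt} (hz : z ≠ 0) : ∃! u : GaussianIntˣ, IsTurn z u := by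
  obtain ⟨x, y⟩ := z
  have hxy : x ≠ 0 ∨ y ≠ 0 := by
    by_contra! h
    exact hz (by rw [h.1, h.2]; rfl)
  have hI : I * I = -1 := by decide
  let uI : GaussianIntˣ := ⟨I, -I, by decide, by decide⟩
  have hU : ∀ u : GaussianIntˣ, u = 1 ∨ u = -1 ∨ u = uI ∨ u = -uI := by
    intro u
    have h1 : Zsqrtd.norm (u : GaussianInt) = 1 :=
      (Zsqrtd.norm_eq_one_iff' (by norm_num) _).2 u.isUnit
    rw [Zsqrtd.norm_def] at h1
    have hre : (u : GaussianInt).re ≤ 1 ∧ -1 ≤ (u : GaussianInt).re := by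
      constructor <;> nlinarith [sq_nonneg (u : GaussianInt).im]
    have him : (u : GaussianInt).im ≤ 1 ∧ -1 ≤ (u : GaussianInt).im := by
      constructor <;> nlinarith [sq_nonneg (u : GaussianInt).re]
    have key : ∀ p t : ℤ, p ≤ 1 ∧ -1 ≤ p → t ≤ 1 ∧ -1 ≤ t → p * p - -1 * t * t = 1 →
        (p = 1 ∧ t = 0) ∨ (p = -1 ∧ t = 0) ∨ (p = 0 ∧ t = 1) ∨ (p = 0 ∧ t = -1) := by
      rintro p t ⟨h2, h3⟩ ⟨h4, h5⟩ h6
      interval_cases p <;> interval_cases t <;> simp_all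
    rcases key _ _ hre him h1 with h | h | h | h
    · exact Or.inl (Units.ext (Zsqrtd.ext h.1 h.2))
    · exact Or.inr (Or.inl (Units.ext (Zsqrtd.ext h.1 h.2)))
    · exact Or.inr (Or.inr (Or.inl (Units.ext (Zsqrtd.ext h.1 h.2))))
    · exact Or.inr (Or.inr (Or.inr (Units.ext (Zsqrtd.ext h.1 h.2))))
  have e1 : IsTurn ⟨x, y⟩ 1 ↔ (max |x| |y| ≠ |x| + |y| - max |x| |y| → x = max |x| |y|) ∧
      (max |x| |y| = |x| + |y| - max |x| |y| → x = max |x| |y| ∧ y = max |x| |y|) := by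
    simp [IsTurn, lInf, lOne, m, Zsqrtd.ext_iff, I]
  have e2 : IsTurn ⟨x, y⟩ (-1) ↔ (max |x| |y| ≠ |x| + |y| - max |x| |y| → -x = max |x| |y|) ∧
      (max |x| |y| = |x| + |y| - max |x| |y| → -x = max |x| |y| ∧ -y = max |x| |y|) := by
    simp [IsTurn, lInf, lOne, m, Zsqrtd.ext_iff, I]
  have e3 : IsTurn ⟨x, y⟩ uI ↔ (max |x| |y| ≠ |x| + |y| - max |x| |y| → -y = max |x| |y|) ∧
      (max |x| |y| = |x| + |y| - max |x| |y| → -y = max |x| |y| ∧ x = max |x| |y|) := by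
    simp [IsTurn, lInf, lOne, m, Zsqrtd.ext_iff, I, uI]
  have e4 : IsTurn ⟨x, y⟩ (-uI) ↔ (max |x| |y| ≠ |x| + |y| - max |x| |y| → y = max |x| |y|) ∧
      (max |x| |y| = |x| + |y| - max |x| |y| → y = max |x| |y| ∧ -x = max |x| |y|) := by
    simp [IsTurn, lInf, lOne, m, Zsqrtd.ext_iff, I, uI]
  have hE : IsTurn ⟨x, y⟩ 1 ∨ IsTurn ⟨x, y⟩ (-1) ∨ IsTurn ⟨x, y⟩ uI ∨ IsTurn ⟨x, y⟩ (-uI) := by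
    rw [e1, e2, e3, e4]
    rcases abs_cases x with ⟨hx, _⟩ | ⟨hx, _⟩ <;> rcases abs_cases y with ⟨hy, _⟩ | ⟨hy, _⟩ <;>
      rcases max_cases |x| |y| with ⟨hm, _⟩ | ⟨hm, _⟩ <;> rw [hm] <;> omega
  have hN : ∀ u v : GaussianIntˣ, IsTurn ⟨x, y⟩ u → IsTurn ⟨x, y⟩ v → u = v := by
    intro u v hu hv
    rcases hU u with rfl | rfl | rfl | rfl <;> rcases hU v with rfl | rfl | rfl | rfl <;>
      first
      | rfl
      | (exfalso
         simp only [e1, e2, e3, e4] at hu hv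
         clear e1 e2 e3 e4 hE hU
         rcases abs_cases x with ⟨hx, _⟩ | ⟨hx, _⟩ <;> rcases abs_cases y with ⟨hy, _⟩ | ⟨hy, _⟩ <;>
           rcases max_cases |x| |y| with ⟨hm, _⟩ | ⟨hm, _⟩ <;> rw [hm] at hu hv <;> omega)
  rcases hE with h | h | h | h
  · exact ⟨1, h, fun v hv => hN v _ hv h⟩
  · exact ⟨-1, h, fun v hv => hN v _ hv h⟩
  · exact ⟨uI, h, fun v hv => hN v _ hv h⟩
  · exact ⟨-uI, h, fun v hv => hN v _ hv h⟩

open Classical in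
/-- The unit `u_z` for `z ≠ 0`: it satisfies `Re (u_z z) = ℓ_∞(z)` if `ℓ_∞(z) ≠ m(z)`, and
`u_z z = ℓ_∞(z) (1 + i)` if `ℓ_∞(z) = m(z)`. (The value for `z = 0` is arbitrary.) -/
noncomputable def turn (z : GaussianInt) : GaussianIntˣ :=
  if hz : z ≠ 0 then (existsUnique_isTurn hz).choose else 1

/-- The defining property of `u_z`. -/
theorem isTurn_turn {z : GaussianInt} (hz : z ≠ 0) : IsTurn z (turn z) := by
  rw [turn, dif_pos hz]
  exact (existsUnique_isTurn hz).choose_spec.1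

/-- `s(r) = sgn (Im (u_r r))`. -/
noncomputable def s (r : GaussianInt) : ℤ := ((turn r : GaussianInt) * r).im.sign

/-- The nearest integer, where halves are rounded down. -/
def nint (x : ℚ) : ℤ := if x - ⌊x⌋ ≤ 1 / 2 then ⌊x⌋ else ⌈x⌉

/-- The Gauss quotient of `a` and `b`: the real and imaginary parts of `a / b`, computed as
`a * conj b / Nm b`, are rounded to nearest integers. -/
def gaussQuotient (a b : GaussianInt) : GaussianInt :=
  ⟨nint (((a * star b).re : ℚ) / (Zsqrtd.norm b : ℚ)),
    nint (((a * star b).im : ℚ) / (Zsqrtd.norm b : ℚ))⟩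

/-- The Gauss remainder of `a` and `b`. -/
def gaussRemainder (a b : GaussianInt) : GaussianInt := a - gaussQuotient a b * b

end GaussDiv

/-! The sets `{z | φ z ≤ n}` are explicit: apart from `0` they consist of the `z` with `ℓ_∞(z) +
2·2^v ≤ w n` and `ℓ_1(z) + 3·2^v ≤ w (n + 1)`, where `v = v2 z`. This is `InLevel n`, an octagon
whose size depends on the power of two in `z`. Once it is identified with `φ ≤ n`
(`minEuclid_le_iff`), the theorem is a statement about integer inequalities.

The correction (`exists_correction`): a Gauss remainder satisfies `2 ℓ_∞(r) ≤ ℓ_1(b)` and `ℓ_1(r) ≤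
ℓ_∞(b)`. If `b` is in level `n + 1` and `r` is not in level `n`, these bounds leave only a few
shapes for `r` relative to `b` (`exists_remainderShape`). After both are rotated towards the
positive real axis, subtracting `b`, or else `± i b`, lands in level `n`; the three conditions
decide which.

The identification: the correction shows that the least level is a Euclidean function, so `φ` is at
most the level. Conversely, let `f` be Euclidean with `f z ≤ n + 1`. Divide by `z` an element `c`
outside level `n` with `c - r` in level `n + 1` for all `r` in level `n` (`exists_not_inLevel`). By
induction the remainder is in level `n`, so `z` divides a nonzero multiple of itself lying in level
`n + 1`, and levels are closed under divisors (`InLevel.of_mul`). -/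

namespace GaussDiv

/-! ### Units and the power of two in a Gaussian integer -/

theorem unit_cases (u : GaussianIntˣ) : (u : GaussianInt) = ⟨1, 0⟩ ∨ (u : GaussianInt) = ⟨-1, 0⟩ ∨
    (u : GaussianInt) = ⟨0, 1⟩ ∨ (u : GaussianInt) = ⟨0, -1⟩ := by
  have h1 : Zsqrtd.norm (u : GaussianInt) = 1 :=
    (Zsqrtd.norm_eq_one_iff' (by norm_num) _).2 u.isUnit
  generalize (u : GaussianInt) = z at h1
  obtain ⟨p, t⟩ := z
  rw [Zsqrtd.norm_def] at h1
  simp only at h1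
  have hp : -1 ≤ p ∧ p ≤ 1 := by constructor <;> nlinarith [sq_nonneg t]
  have ht : -1 ≤ t ∧ t ≤ 1 := by constructor <;> nlinarith [sq_nonneg p]
  obtain ⟨hp1, hp2⟩ := hp
  obtain ⟨ht1, ht2⟩ := ht
  interval_cases p <;> interval_cases t <;> simp_all

theorem lInf_unit_mul (u : GaussianIntˣ) (z : GaussianInt) : lInf (u * z) = lInf z := by
  rcases unit_cases u with h | h | h | h <;> rw [h] <;> simp [lInf, max_comm]

theorem lOne_unit_mul (u : GaussianIntˣ) (z : GaussianInt) : lOne (u * z) = lOne z := by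
  rcases unit_cases u with h | h | h | h <;> rw [h] <;> simp [lOne, add_comm]

theorem v2_unit_mul (u : GaussianIntˣ) (z : GaussianInt) : v2 (u * z) = v2 z := by
  apply multiplicity_eq_of_associated_right
  exact associated_unit_mul_left z _ u.isUnit

theorem lInf_nonneg (z : GaussianInt) : 0 ≤ lInf z := le_max_of_le_left (abs_nonneg _)

theorem lOne_nonneg (z : GaussianInt) : 0 ≤ lOne z := by unfold lOne; positivity

theorem two_pow_dvd_iff (j : ℕ) (z : GaussianInt) :
    (2 : GaussianInt) ^ j ∣ z ↔ (2 : ℤ) ^ j ∣ z.re ∧ (2 : ℤ) ^ j ∣ z.im := by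
  rw [← Zsqrtd.intCast_dvd]
  push_cast
  rfl

theorem v2_eq {z : GaussianInt} {j : ℕ} {X Y : ℤ} (hre : z.re = 2 ^ j * X) (him : z.im = 2 ^ j * Y)
    (hodd : X % 2 = 1 ∨ Y % 2 = 1) : v2 z = j := by
  have hpos : (2 : ℤ) ^ j ≠ 0 := by positivity
  apply multiplicity_eq_of_dvd_of_not_dvd
  · rw [two_pow_dvd_iff, hre, him]
    exact ⟨dvd_mul_right _ _, dvd_mul_right _ _⟩
  · rw [two_pow_dvd_iff, hre, him, pow_succ, mul_dvd_mul_iff_left hpos, mul_dvd_mul_iff_left hpos]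
    omega

theorem exists_dyadic {z : GaussianInt} (hz : z ≠ 0) : ∃ (j : ℕ) (X Y : ℤ), z.re = 2 ^ j * X ∧
    z.im = 2 ^ j * Y ∧ (X % 2 = 1 ∨ Y % 2 = 1) ∧ v2 z = j := by
  have hfin : FiniteMultiplicity (2 : GaussianInt) z := by
    apply FiniteMultiplicity.of_not_isUnit _ hz
    intro h
    rw [← Zsqrtd.norm_eq_one_iff' (by norm_num)] at h
    exact absurd h (by decide)
  have h1 : (2 : GaussianInt) ^ v2 z ∣ z := pow_multiplicity_dvd _ _
  have h2 : ¬ (2 : GaussianInt) ^ (v2 z + 1) ∣ z := hfin.not_pow_dvd_of_multiplicity_lt (Nat.lt_succ_self _)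
  rw [two_pow_dvd_iff] at h1 h2
  obtain ⟨⟨X, hX⟩, ⟨Y, hY⟩⟩ := h1
  have hpos : (2 : ℤ) ^ v2 z ≠ 0 := by positivity
  refine ⟨v2 z, X, Y, hX, hY, ?_, rfl⟩
  rw [hX, hY, pow_succ, mul_dvd_mul_iff_left hpos, mul_dvd_mul_iff_left hpos] at h2
  omega

/-! ### The sequence `w` and the levels -/

theorem w_even (k : ℕ) : w (2 * k) = 3 * 2 ^ k := by simp [w]

theorem w_odd (k : ℕ) : w (2 * k + 1) = 4 * 2 ^ k := by
  have : (2 * k + 1) / 2 = k := by omega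
  simp [w, this]

theorem exists_w (n : ℕ) : ∃ k : ℕ, (n = 2 * k ∧ w n = 3 * 2 ^ k ∧ w (n + 1) = 4 * 2 ^ k) ∨
    (n = 2 * k + 1 ∧ w n = 4 * 2 ^ k ∧ w (n + 1) = 6 * 2 ^ k) := by
  obtain ⟨k, rfl | rfl⟩ := Nat.even_or_odd' n
  · exact ⟨k, Or.inl ⟨rfl, w_even k, w_odd k⟩⟩
  · refine ⟨k, Or.inr ⟨rfl, w_odd k, ?_⟩⟩
    rw [show 2 * k + 1 + 1 = 2 * (k + 1) by ring, w_even]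
    ring

theorem w_add_two (n : ℕ) : w (n + 2) = 2 * w n := by
  obtain ⟨k, rfl | rfl⟩ := Nat.even_or_odd' n
  · rw [show 2 * k + 2 = 2 * (k + 1) by ring, w_even, w_even]; ring
  · rw [show 2 * k + 1 + 2 = 2 * (k + 1) + 1 by ring, w_odd, w_odd]; ring

theorem w_le_succ (n : ℕ) : w n ≤ w (n + 1) := by
  obtain ⟨k, ⟨-, h1, h2⟩ | ⟨-, h1, h2⟩⟩ := exists_w n <;> rw [h1, h2] <;>
    linarith [pow_pos (zero_lt_two' ℤ) k]

/-- The explicit description of the elements `z` with `φ z ≤ n`, together with `0`. -/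
def InLevel (n : ℕ) (z : GaussianInt) : Prop :=
  z = 0 ∨ lInf z + 2 * 2 ^ v2 z ≤ w n ∧ lOne z + 3 * 2 ^ v2 z ≤ w (n + 1)

theorem InLevel.mono {n k : ℕ} (hnk : n ≤ k) {z : GaussianInt} (h : InLevel n z) : InLevel k z := by
  have hw : Monotone w := monotone_nat_of_le_succ w_le_succ
  rcases h with h | ⟨h1, h2⟩
  · exact Or.inl h
  · exact Or.inr ⟨h1.trans (hw hnk), h2.trans (hw (Nat.succ_le_succ hnk))⟩

/-- Since `w` grows exponentially, every element is caught; hence the infimum defining `level` is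
over a nonempty set. -/
theorem exists_inLevel (z : GaussianInt) : ∃ n, InLevel n z := by
  set N : ℤ := lOne z + lInf z + 3 * 2 ^ v2 z with hN
  have h0 := lOne_nonneg z
  have h1 := lInf_nonneg z
  have h2 : (0 : ℤ) < 2 ^ v2 z := by positivity
  have h3 : (N.toNat : ℤ) < 2 ^ N.toNat := by exact_mod_cast Nat.lt_two_pow_self
  have h4 := w_le_succ (2 * N.toNat)
  have h5 := w_even N.toNat
  exact ⟨2 * N.toNat, Or.inr ⟨by omega, by omega⟩⟩

theorem inLevel_unit_mul (n : ℕ) (u : GaussianIntˣ) (z : GaussianInt) :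
    InLevel n (u * z) ↔ InLevel n z := by
  rw [InLevel, InLevel, lInf_unit_mul, lOne_unit_mul, v2_unit_mul, Units.mul_right_eq_zero]

theorem inLevel_iff {z : GaussianInt} {n j : ℕ} {X Y : ℤ} (hre : z.re = 2 ^ j * X)
    (him : z.im = 2 ^ j * Y) (hodd : X % 2 = 1 ∨ Y % 2 = 1) :
    InLevel n z ↔ 2 ^ j * (max |X| |Y| + 2) ≤ w n ∧ 2 ^ j * (|X| + |Y| + 3) ≤ w (n + 1) := by
  have hpos : (0 : ℤ) < 2 ^ j := by positivity
  have hz : z ≠ 0 := by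
    rintro rfl
    simp only [Zsqrtd.re_zero, Zsqrtd.im_zero, zero_eq_mul, hpos.ne', false_or] at hre him
    omega
  have e1 : lInf z + 2 * 2 ^ j = 2 ^ j * (max |X| |Y| + 2) := by
    rw [lInf, hre, him, abs_mul, abs_mul, abs_of_pos hpos, ← mul_max_of_nonneg _ _ hpos.le]
    ring
  have e2 : lOne z + 3 * 2 ^ j = 2 ^ j * (|X| + |Y| + 3) := by
    rw [lOne, hre, him, abs_mul, abs_mul, abs_of_pos hpos]
    ring
  rw [InLevel, v2_eq hre him hodd, e1, e2]
  simp [hz]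

/-! ### Shapes of Gauss remainders outside a level -/

/-- The possible shapes of a remainder with parts of absolute values `x ≥ y` outside of the level
with bounds `W`, `W'` modulo a divisor whose larger part has absolute value `X`. Everything is
divided by the power of two in the divisor, and `t` is the power of two left in the remainder. -/
def RemainderShape (K W W' X t x y : ℤ) : Prop :=
  (x % 2 = 1 ∧ y % 2 = 1 ∧ x + y = X ∧ X = W' - 2) ∨
  (x % 2 = 0 ∧ y % 2 = 0 ∧ 2 ≤ t ∧
    ((t ≤ K ∧ x = W - t ∧ (y = W' - W ∨ y ≤ W' - W - t) ∧ (y = 0 ∨ t ≤ y)) ∨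
      (t ≤ K ∧ x ≤ W - 2 * t ∧ (x + y = W' - t ∨ x + y = W' - 2 * t)) ∨
      (t = 2 * K ∧ x = 2 * K ∧ (y = 0 ∨ y = 2 * K))))

/-- The upper bounds `h1`, `h2` from Gauss division nearly contradict being outside the level
(`hR`), so the larger part or the sum of the parts lies within a few multiples of `t` of its
maximum. Here `2 ^ j` and `2 ^ l` are the powers of two in divisor and remainder, `t = 2 ^ (l - j)`,
and `K` is `2 ^ (k - j)` for the power `2 ^ k` in `w n`. -/
theorem exists_remainderShape {n j l : ℕ} {X Y p q : ℤ} (hY : 0 ≤ Y) (hYX : Y ≤ X) (hq : 0 ≤ q)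
    (hqp : q ≤ p) (hp : 0 < p) (hX : 0 < X) (hpq : p % 2 = 1 ∨ q % 2 = 1)
    (hB : 2 ^ j * (X + 2) ≤ w (n + 1)) (hB' : 2 ^ j * (X + Y + 3) ≤ 2 * w n)
    (hR : ¬ (2 ^ l * (p + 2) ≤ w n ∧ 2 ^ l * (p + q + 3) ≤ w (n + 1)))
    (h1 : 2 * (2 ^ l * p) ≤ 2 ^ j * (X + Y)) (h2 : 2 ^ l * (p + q) ≤ 2 ^ j * X) :
    ∃ K W W' t : ℤ, (W = 3 * K ∧ W' = 4 * K ∨ W = 4 * K ∧ W' = 6 * K) ∧ w n = 2 ^ j * W ∧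
      w (n + 1) = 2 ^ j * W' ∧ (2 : ℤ) ^ l = 2 ^ j * t ∧
      RemainderShape K W W' X t (t * p) (t * q) := by
  obtain ⟨k, hk⟩ := exists_w n
  have hVpos : (0 : ℤ) < 2 ^ j := by positivity
  have hLpos : (0 : ℤ) < 2 ^ l := by positivity
  have hKpos : (0 : ℤ) < 2 ^ k := by positivity
  have hlt : ∀ {a b : ℕ}, a < b → 2 * (2 : ℤ) ^ a ≤ 2 ^ b := by
    intro a b hab
    rw [← pow_succ']
    exact pow_le_pow_right₀ (by norm_num) hab
  -- If `2 * 2 ^ l ≤ 2 ^ j`, the level bounds on the divisor, combined with `h1` and `h2`, put the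
  -- remainder in the level.
  have hjl : j ≤ l := by
    by_contra! hlj
    have := hlt hlj
    exact hR ⟨by linarith, by linarith⟩
  -- A larger `j` leaves only the divisor with `X = 1`, `Y = 0`, and its Gauss remainders are all in
  -- the level.
  have hjk : j ≤ k := by
    by_contra! hkj
    have h3 := hlt hkj
    rcases hk with ⟨-, hw, hw'⟩ | ⟨-, hw, hw'⟩
    · nlinarith
    · have hX1 : X = 1 := by
        by_contra hne
        have : 2 ≤ X := by omega
        nlinarith
      subst hX1
      have hY0 : Y = 0 := by
        by_contra hne
        have : 1 ≤ Y := by omega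
        nlinarith
      subst hY0
      have : (2 : ℤ) ^ l ≤ 2 ^ l * p := le_mul_of_one_le_right hLpos.le hp
      exact hR ⟨by linarith, by linarith⟩
  obtain ⟨d, rfl⟩ := Nat.exists_eq_add_of_le hjl
  obtain ⟨e, rfl⟩ := Nat.exists_eq_add_of_le hjk
  rw [pow_add] at hk hR h1 h2
  generalize hV : (2 : ℤ) ^ j = V at *
  have hk' : ∃ W W' : ℤ, (W = 3 * 2 ^ e ∧ W' = 4 * 2 ^ e ∨ W = 4 * 2 ^ e ∧ W' = 6 * 2 ^ e) ∧
      w n = V * W ∧ w (n + 1) = V * W' := by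
    rcases hk with ⟨-, hw, hw'⟩ | ⟨-, hw, hw'⟩
    · exact ⟨_, _, Or.inl ⟨rfl, rfl⟩, by linarith, by linarith⟩
    · exact ⟨_, _, Or.inr ⟨rfl, rfl⟩, by linarith, by linarith⟩
  obtain ⟨W, W', hWW, hw, hw'⟩ := hk'
  refine ⟨2 ^ e, W, W', 2 ^ d, hWW, hw, hw', by rw [pow_add, hV], ?_⟩
  rw [hw, hw', mul_assoc, mul_assoc, mul_le_mul_iff_right₀ hVpos, mul_le_mul_iff_right₀ hVpos] at hR
  rw [hw', mul_le_mul_iff_right₀ hVpos] at hB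
  rw [hw, mul_left_comm, mul_le_mul_iff_right₀ hVpos] at hB'
  rw [mul_assoc, mul_left_comm, mul_le_mul_iff_right₀ hVpos] at h1
  rw [mul_assoc, mul_le_mul_iff_right₀ hVpos] at h2
  unfold RemainderShape
  -- For `t = 1` only the `ℓ_1` bound can fail, which forces `p + q = X = W' - 2`; this is even, so
  -- both parts are odd.
  rcases Nat.eq_zero_or_pos d with rfl | hd
  · left
    simp only [pow_zero, one_mul] at *
    omega
  right
  have ht : ∃ s : ℤ, (2 : ℤ) ^ d = 2 * s ∧ 0 < s :=
    ⟨2 ^ (d - 1), by rw [← pow_succ', Nat.sub_add_cancel hd], by positivity⟩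
  obtain ⟨s, hs, hspos⟩ := ht
  refine ⟨by rw [hs, mul_assoc]; omega, by rw [hs, mul_assoc]; omega, by omega, ?_⟩
  rcases le_or_gt d e with hde | hed
  · obtain ⟨c, rfl⟩ := Nat.exists_eq_add_of_le hde
    have hcpos : (0 : ℤ) < 2 ^ c := by positivity
    have htpos : (0 : ℤ) < 2 ^ d := by positivity
    rw [pow_add] at hWW ⊢
    have hW2 : ∃ U U' : ℤ, (U = 3 * 2 ^ c ∧ U' = 4 * 2 ^ c ∨ U = 4 * 2 ^ c ∧ U' = 6 * 2 ^ c) ∧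
        W = 2 ^ d * U ∧ W' = 2 ^ d * U' := by
      rcases hWW with ⟨rfl, rfl⟩ | ⟨rfl, rfl⟩
      · exact ⟨_, _, Or.inl ⟨rfl, rfl⟩, by ring, by ring⟩
      · exact ⟨_, _, Or.inr ⟨rfl, rfl⟩, by ring, by ring⟩
    obtain ⟨U, U', hU, rfl, rfl⟩ := hW2
    rw [mul_le_mul_iff_right₀ htpos, mul_le_mul_iff_right₀ htpos] at hR
    have hpU : p < U := by
      apply lt_of_mul_lt_mul_left _ htpos.le
      omega
    have hpqU : p + q < U' := by
      apply lt_of_mul_lt_mul_left _ htpos.le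
      omega
    have htK : (2 : ℤ) ^ d ≤ 2 ^ d * 2 ^ c := le_mul_of_one_le_right htpos.le hcpos
    -- Strictly below `U` and `U'`, yet failing `p + 2 ≤ U` or `p + q + 3 ≤ U'`: only these values
    -- remain.
    have hcases : (p = U - 1 ∧ (q = U' - U ∨ q ≤ U' - U - 1) ∧ (q = 0 ∨ 1 ≤ q)) ∨
        (p ≤ U - 2 ∧ (p + q = U' - 1 ∨ p + q = U' - 2)) := by omega
    rcases hcases with ⟨h3, h4, h5⟩ | ⟨h3, h4⟩
    · left
      refine ⟨htK, by rw [h3]; ring, ?_, ?_⟩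
      · rcases h4 with h4 | h4
        · left; rw [h4]; ring
        · right; nlinarith
      · rcases h5 with h5 | h5
        · left; rw [h5, mul_zero]
        · right; nlinarith
    · right; left
      refine ⟨htK, by nlinarith, ?_⟩
      rcases h4 with h4 | h4
      · left; rw [← mul_add, h4]; ring
      · right; rw [← mul_add, h4]; ring
  · right; right
    have hepos : (0 : ℤ) < 2 ^ e := by positivity
    have hde : d = e + 1 := by
      by_contra hne
      have h3 : (2 : ℤ) ^ (e + 2) ≤ 2 ^ d := pow_le_pow_right₀ (by norm_num) (by omega)
      rw [pow_add] at h3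
      have : (2 : ℤ) ^ d ≤ 2 ^ d * p := le_mul_of_one_le_right (by positivity) hp
      omega
    subst hde
    have hp1 : p = 1 := by
      by_contra hne
      have : 2 ≤ p := by omega
      have h3 : (2 : ℤ) ^ (e + 1) * 2 ≤ 2 ^ (e + 1) * p := by gcongr
      rw [pow_succ] at h1 h3
      rcases hWW with ⟨rfl, rfl⟩ | ⟨rfl, rfl⟩ <;> linarith
    subst hp1
    refine ⟨by ring, by ring, ?_⟩
    have : q = 0 ∨ q = 1 := by omega
    rcases this with rfl | rfl
    · left; ring
    · right; ring

/-! ### Integer inequalities for the corrected remainders -/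

section Bounds

variable {K W W' X Y x y t : ℤ}

/-- The case of imaginary parts of equal sign: `R - B` has parts `X - x` and `|Y - y|`. Every shape
has `x ≥ W' - W`, whence `X - x + 2 ≤ W' - x ≤ W`. -/
theorem RemainderShape.sub_bounds (hW : W = 3 * K ∧ W' = 4 * K ∨ W = 4 * K ∧ W' = 6 * K)
    (hYX : Y ≤ X) (hY : 0 ≤ Y) (hyx : y ≤ x) (hy : 0 ≤ y) (hX : X + 2 ≤ W') (hXY : X + Y + 3 ≤ 2 * W)
    (h1 : 2 * x ≤ X + Y) (h2 : x + y ≤ X) (hodd : X % 2 = 1 ∨ Y % 2 = 1)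
    (h : RemainderShape K W W' X t x y) :
    X - x + 2 ≤ W ∧ Y - y + 2 ≤ W ∧ y - Y + 2 ≤ W ∧ X - x + (Y - y) + 3 ≤ W' ∧
      X - x + (y - Y) + 3 ≤ W' := by
  unfold RemainderShape at h
  omega

/-- The case of opposite signs: `R - B` has parts `X - x` and `Y + y`. Their sum is at most `X`
exactly when `y + Y ≤ x`; as `X ≤ W' - 2`, this misses the `ℓ_1` bound by at most one, and parity
gains that one. -/
theorem RemainderShape.add_bounds (hW : W = 3 * K ∧ W' = 4 * K ∨ W = 4 * K ∧ W' = 6 * K)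
    (hY : 0 < Y) (hyx : y ≤ x) (hy : 0 < y) (hX : X + 2 ≤ W')
    (hXY : X + Y + 3 ≤ 2 * W) (h1 : 2 * x ≤ X + Y) (h2 : x + y ≤ X)
    (hodd : X % 2 = 1 ∨ Y % 2 = 1) (h : RemainderShape K W W' X t x y)
    (hC : y + Y ≤ x ∨ Y < x ∧ x < Y + y ∧ W - 2 < X - y) :
    X - x + 2 ≤ W ∧ Y + y + 2 ≤ W ∧ X - x + (Y + y) + 3 ≤ W' := by
  unfold RemainderShape at h
  omega

/-- Opposite signs, with `B` turned by a right angle: the parts are `X - y` and `|x - Y|`. The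
inequality `W - 2 < X - y` in the third condition is the negation of the first bound here. -/
theorem RemainderShape.turned_bounds (hW : W = 3 * K ∧ W' = 4 * K ∨ W = 4 * K ∧ W' = 6 * K)
    (hYX : Y ≤ X) (hY : 0 < Y) (hyx : y ≤ x) (hy : 0 < y) (hX : X + 2 ≤ W')
    (hXY : X + Y + 3 ≤ 2 * W) (h1 : 2 * x ≤ X + Y) (h2 : x + y ≤ X)
    (hodd : X % 2 = 1 ∨ Y % 2 = 1) (h : RemainderShape K W W' X t x y)
    (hC : ¬ (y + Y ≤ x ∨ Y < x ∧ x < Y + y ∧ W - 2 < X - y)) :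
    X - y + 2 ≤ W ∧ x - Y + 2 ≤ W ∧ Y - x + 2 ≤ W ∧ X - y + (x - Y) + 3 ≤ W' ∧
      X - y + (Y - x) + 3 ≤ W' := by
  unfold RemainderShape at h
  omega

/-- With `turned_parity`, this shows that the corrected remainder contains the same power of two as
the divisor. Either `x`, `y` are both even, or both are odd with `X = x + y` even and hence `Y` odd.
-/
theorem RemainderShape.sub_parity
    (hodd : X % 2 = 1 ∨ Y % 2 = 1) (h : RemainderShape K W W' X t x y) :
    (x - X) % 2 = 1 ∨ (y - Y) % 2 = 1 := by
  unfold RemainderShape at h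
  omega

theorem RemainderShape.turned_parity
    (hodd : X % 2 = 1 ∨ Y % 2 = 1) (h : RemainderShape K W W' X t x y) :
    (x - Y) % 2 = 1 ∨ (y - X) % 2 = 1 := by
  unfold RemainderShape at h
  omega

end Bounds

/-! ### The correction of a Gauss remainder -/

/-- The condition under which `r - (u_b / u_r) b` is the remainder to take, for `B = u_b b` and
`R = u_r r`. -/
def KeepsDirection (n : ℕ) (B R : GaussianInt) : Prop :=
  0 ≤ B.im * R.im ∨ |R.im| + |B.im| ≤ R.re ∨
    (|B.im| < R.re ∧ R.re < |B.im| + |R.im| ∧ w n - 2 ^ (v2 B + 1) < B.re - |R.im|)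

theorem inLevel_of_normalized {n : ℕ} {B R : GaussianInt} (hB : |B.im| ≤ B.re) (hR : |R.im| ≤ R.re)
    (hR0 : 0 < R.re) (h1 : 2 * R.re ≤ B.re + |B.im|) (h2 : R.re + |R.im| ≤ B.re)
    (hBn : InLevel (n + 1) B) (hRn : ¬ InLevel n R) :
    (KeepsDirection n B R → InLevel n (R - B)) ∧
    (¬ KeepsDirection n B R → R.im.sign ≠ 0 ∧ InLevel n (R - (R.im.sign : GaussianInt) * (I * B))) := by
  have hB0 : 0 < B.re := by linarith [abs_nonneg R.im]
  have hBne : B ≠ 0 := by rintro rfl; simp at hB0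
  have hRne : R ≠ 0 := by rintro rfl; simp at hR0
  obtain ⟨j, X, Y, hX, hY, hXY, hj⟩ := exists_dyadic hBne
  obtain ⟨l, p, q, hp, hq, hpq, -⟩ := exists_dyadic hRne
  have hVpos : (0 : ℤ) < 2 ^ j := by positivity
  have hLpos : (0 : ℤ) < 2 ^ l := by positivity
  rw [inLevel_iff hX hY hXY, w_add_two] at hBn
  rw [inLevel_iff hp hq hpq] at hRn
  rw [hX] at hB0 h2
  rw [hp] at hR0
  have hX0 : 0 < X := pos_of_mul_pos_right hB0 hVpos.le
  have hp0 : 0 < p := pos_of_mul_pos_right hR0 hLpos.le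
  rw [hX, hY, abs_mul, abs_of_pos hVpos, mul_le_mul_iff_right₀ hVpos] at hB
  rw [hp, hq, abs_mul, abs_of_pos hLpos, mul_le_mul_iff_right₀ hLpos] at hR
  rw [abs_of_pos hX0, max_eq_left hB] at hBn
  rw [abs_of_pos hp0, max_eq_left hR] at hRn
  rw [hp, hX, hY, abs_mul, abs_of_pos hVpos, ← mul_add] at h1
  rw [hp, hq, abs_mul, abs_of_pos hLpos, ← mul_add] at h2
  have hpq' : p % 2 = 1 ∨ |q| % 2 = 1 := by
    rcases abs_cases q with ⟨h, -⟩ | ⟨h, -⟩ <;> rw [h] <;> omega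
  have hXY' : X % 2 = 1 ∨ |Y| % 2 = 1 := by
    rcases abs_cases Y with ⟨h, -⟩ | ⟨h, -⟩ <;> rw [h] <;> omega
  obtain ⟨K, W, W', t, hW, hw, hw', ht, hshape⟩ := exists_remainderShape (abs_nonneg Y) hB
    (abs_nonneg q) hR hp0 hX0 hpq' hBn.1 hBn.2 hRn h1 h2
  have ht0 : 0 < t := by
    rw [ht] at hLpos
    exact pos_of_mul_pos_right hLpos hVpos.le
  have hsq : R.im.sign = (t * q).sign := by
    rw [hq, Int.sign_mul, Int.sign_mul, Int.sign_eq_one_of_pos hLpos, Int.sign_eq_one_of_pos ht0]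
  rw [ht, mul_assoc] at hp hq
  rw [hw, hw', mul_le_mul_iff_right₀ hVpos, mul_left_comm, mul_le_mul_iff_right₀ hVpos] at hBn
  rw [ht, mul_assoc, mul_left_comm, mul_le_mul_iff_right₀ hVpos] at h1
  rw [ht, mul_assoc, mul_le_mul_iff_right₀ hVpos, mul_add] at h2
  have hR' : t * |q| ≤ t * p := mul_le_mul_of_nonneg_left hR ht0.le
  have htq : t * |q| = |t * q| := by rw [abs_mul, abs_of_pos ht0]
  rw [htq] at hR' hshape h2
  clear hRn htq
  generalize t * p = x at *
  generalize t * q = y at *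
  obtain ⟨hB1, hB2⟩ := hBn
  -- Division by `2 ^ j` with `j = v2 B` turns the threshold `w n - 2 ^ (v2 B + 1)` into `W - 2`.
  have hkeep : KeepsDirection n B R ↔ 0 ≤ Y * y ∨ |y| + |Y| ≤ x ∨
      (|Y| < x ∧ x < |Y| + |y| ∧ W - 2 < X - |y|) := by
    have e1 : B.im * R.im = 2 ^ j * (2 ^ j * (Y * y)) := by rw [hY, hq]; ring
    rw [KeepsDirection, e1, hX, hY, hp, hq, hj, hw, pow_succ, abs_mul, abs_mul, abs_of_pos hVpos,
      ← mul_add, ← mul_add, ← mul_sub, ← mul_sub]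
    simp only [mul_le_mul_iff_right₀ hVpos, mul_lt_mul_iff_right₀ hVpos,
      mul_nonneg_iff_of_pos_left hVpos]
  have hy0 := abs_nonneg y
  have hY0 := abs_nonneg Y
  have hsub := hshape.sub_parity hXY'
  have hturn := hshape.turned_parity hXY'
  rw [hkeep]
  constructor
  · intro hC
    have hre : (R - B).re = 2 ^ j * (x - X) := by rw [Zsqrtd.re_sub, hp, hX]; ring
    have him : (R - B).im = 2 ^ j * (y - Y) := by rw [Zsqrtd.im_sub, hq, hY]; ring
    have hodd : (x - X) % 2 = 1 ∨ (y - Y) % 2 = 1 := by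
      rcases abs_cases y with ⟨h, -⟩ | ⟨h, -⟩ <;> rcases abs_cases Y with ⟨h', -⟩ | ⟨h', -⟩ <;>
        rw [h, h'] at hsub <;> omega
    rw [inLevel_iff hre him hodd, hw, hw', mul_le_mul_iff_right₀ hVpos,
      mul_le_mul_iff_right₀ hVpos]
    by_cases hs : 0 ≤ Y * y
    · have hb := hshape.sub_bounds hW hB hY0 hR' hy0 hB1 hB2 h1 h2 hXY'
      rw [mul_nonneg_iff] at hs
      have hyY : |y - Y| = max (|y| - |Y|) (|Y| - |y|) := by
        rcases hs with ⟨h3, h4⟩ | ⟨h3, h4⟩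
        · rw [abs_of_nonneg h3, abs_of_nonneg h4, abs_eq_max_neg, neg_sub]
        · rw [abs_of_nonpos h3, abs_of_nonpos h4, abs_eq_max_neg, max_comm]
          congr 1 <;> ring
      rw [hyY, abs_of_nonpos (by omega : x - X ≤ 0)]
      omega
    · have hs' : (0 < Y ∧ y < 0) ∨ (Y < 0 ∧ 0 < y) := mul_neg_iff.1 (not_le.1 hs)
      have hYp : 0 < |Y| := abs_pos.2 (by omega)
      have hyp : 0 < |y| := abs_pos.2 (by omega)
      have hb := hshape.add_bounds hW hYp hR' hyp hB1 hB2 h1 h2 hXY' (hC.resolve_left hs)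
      have hyY : |y - Y| = |Y| + |y| := by
        rcases hs' with ⟨h3, h4⟩ | ⟨h3, h4⟩
        · rw [abs_of_pos h3, abs_of_neg h4, abs_of_neg (by omega)]; ring
        · rw [abs_of_neg h3, abs_of_pos h4, abs_of_pos (by omega)]; ring
      rw [hyY, abs_of_nonpos (by omega : x - X ≤ 0)]
      omega
  · intro hC
    rw [not_or] at hC
    obtain ⟨hs, hC⟩ := hC
    have hs' : (0 < Y ∧ y < 0) ∨ (Y < 0 ∧ 0 < y) := mul_neg_iff.1 (not_le.1 hs)
    have hYp : 0 < |Y| := abs_pos.2 (by omega)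
    have hyp : 0 < |y| := abs_pos.2 (by omega)
    have hb := hshape.turned_bounds hW hB hYp hR' hyp hB1 hB2 h1 h2 hXY' hC
    rw [hsq]
    refine ⟨by rw [Ne, Int.sign_eq_zero_iff_zero]; omega, ?_⟩
    have hre : (R - (y.sign : GaussianInt) * (I * B)).re = 2 ^ j * (x + y.sign * Y) := by
      simp [I, hp, hY]; ring
    have him : (R - (y.sign : GaussianInt) * (I * B)).im = 2 ^ j * (y - y.sign * X) := by
      simp [I, hq, hX]; ring
    have hxY : x + y.sign * Y = x - |Y| := by
      rcases hs' with ⟨h3, h4⟩ | ⟨h3, h4⟩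
      · rw [Int.sign_eq_neg_one_of_neg h4, abs_of_pos h3]; ring
      · rw [Int.sign_eq_one_of_pos h4, abs_of_neg h3]; ring
    have hyX : y - y.sign * X = y.sign * (|y| - X) := by
      rw [mul_sub, Int.sign_mul_abs]
    have hs1 : |y.sign| = 1 := by
      rcases hs' with ⟨-, h4⟩ | ⟨-, h4⟩
      · rw [Int.sign_eq_neg_one_of_neg h4]; rfl
      · rw [Int.sign_eq_one_of_pos h4]; rfl
    rw [hxY] at hre
    have hodd : (x - |Y|) % 2 = 1 ∨ (y - y.sign * X) % 2 = 1 := by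
      rcases hs' with ⟨-, h4⟩ | ⟨-, h4⟩
      · rw [Int.sign_eq_neg_one_of_neg h4]
        rw [abs_of_neg h4] at hturn
        omega
      · rw [Int.sign_eq_one_of_pos h4]
        rw [abs_of_pos h4] at hturn
        omega
    rw [inLevel_iff hre him hodd, hw, hw', mul_le_mul_iff_right₀ hVpos,
      mul_le_mul_iff_right₀ hVpos, hyX, abs_mul, hs1, one_mul,
      abs_of_nonpos (by omega : |y| - X ≤ 0), abs_eq_max_neg (a := x - |Y|)]
    omega

/-- Needed because `InLevel` admits `0`. If `R` were `B` or `s i B`, then `ℓ_1(R) ≤ ℓ_∞(B)` would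
conflict with `R.re > 0` or with `2 R.re ≤ ℓ_1(B)`. -/
theorem ne_of_normalized {B R : GaussianInt} (hB : |B.im| ≤ B.re) (hR0 : 0 < R.re)
    (h1 : 2 * R.re ≤ B.re + |B.im|) (h2 : R.re + |R.im| ≤ B.re) (s : ℤ) :
    R - B ≠ 0 ∧ R - (s : GaussianInt) * (I * B) ≠ 0 := by
  constructor
  · intro h
    have hre := congrArg Zsqrtd.re h
    have him := congrArg Zsqrtd.im h
    simp only [Zsqrtd.re_sub, Zsqrtd.im_sub, Zsqrtd.re_zero, Zsqrtd.im_zero] at hre him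
    have : R.im = B.im := by omega
    rw [this] at h2
    omega
  · intro h
    have him := congrArg Zsqrtd.im h
    have hre := congrArg Zsqrtd.re h
    simp only [Zsqrtd.re_sub, Zsqrtd.im_sub, Zsqrtd.re_zero, Zsqrtd.im_zero, I, Zsqrtd.re_mul,
      Zsqrtd.im_mul, Zsqrtd.re_intCast, Zsqrtd.im_intCast] at hre him
    rcases eq_or_ne s 0 with rfl | hs
    · simp at hre
      omega
    · have h3 : R.im = s * B.re := by linarith
      have h4 : 1 ≤ |s| := Int.one_le_abs hs
      have h5 : 0 ≤ B.re := (abs_nonneg _).trans hB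
      rw [h3, abs_mul, abs_of_nonneg h5] at h2
      nlinarith

theorem turn_mul_re {z : GaussianInt} (hz : z ≠ 0) : ((turn z : GaussianInt) * z).re = lInf z := by
  by_cases h : lInf z = m z
  · have := (isTurn_turn hz).2 h
    rw [this]
    simp [I]
  · exact (isTurn_turn hz).1 h

theorem abs_turn_mul_im {z : GaussianInt} (hz : z ≠ 0) :
    |((turn z : GaussianInt) * z).im| = m z := by
  have h1 := lOne_unit_mul (turn z) z
  have h2 := lInf_nonneg z
  rw [lOne, turn_mul_re hz, abs_of_nonneg h2] at h1
  rw [m]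
  omega

theorem m_le_lInf (z : GaussianInt) : m z ≤ lInf z := by
  unfold m lOne lInf
  omega

theorem lInf_pos {z : GaussianInt} (hz : z ≠ 0) : 0 < lInf z := by
  rcases (lInf_nonneg z).lt_or_eq with h | h
  · exact h
  · exfalso
    apply hz
    unfold lInf at h
    have h1 := le_max_left |z.re| |z.im|
    have h2 := le_max_right |z.re| |z.im|
    rw [← h] at h1 h2
    exact Zsqrtd.ext (abs_nonpos_iff.1 h1) (abs_nonpos_iff.1 h2)

theorem exists_correction {n : ℕ} {b r : GaussianInt} (hb : b ≠ 0) (hr : r ≠ 0)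
    (h1 : 2 * lInf r ≤ lOne b) (h2 : lOne r ≤ lInf b) (hbn : InLevel (n + 1) b)
    (hrn : ¬ InLevel n r) :
    (KeepsDirection n (turn b * b) (turn r * r) → ∃ c : GaussianInt,
      c * (turn r : GaussianInt) = turn b ∧ r - c * b ≠ 0 ∧ InLevel n (r - c * b)) ∧
    (¬ KeepsDirection n (turn b * b) (turn r * r) → ∃ c : GaussianInt,
      c * ((s r : GaussianInt) * (turn r : GaussianInt)) = I * (turn b : GaussianInt) ∧
        r - c * b ≠ 0 ∧ InLevel n (r - c * b)) := by
  have hbre := turn_mul_re hb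
  have hbim := abs_turn_mul_im hb
  have hrre := turn_mul_re hr
  have hrim := abs_turn_mul_im hr
  rw [← inLevel_unit_mul _ (turn b)] at hbn
  rw [← inLevel_unit_mul _ (turn r)] at hrn
  have hmb : lOne b = lInf b + m b := by rw [m]; ring
  have hmr : lOne r = lInf r + m r := by rw [m]; ring
  have hB := m_le_lInf b
  have hR := m_le_lInf r
  have hr0 := lInf_pos hr
  rw [hmb] at h1
  rw [hmr] at h2
  rw [← hbre, ← hbim] at hB h1
  rw [← hrre, ← hrim] at hR h2
  rw [← hrre] at h1 hr0
  rw [← hbre] at h2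
  have key := inLevel_of_normalized hB hR hr0 h1 h2 hbn hrn
  have hne := ne_of_normalized hB hr0 h1 h2 (s r)
  have huv : (turn r : GaussianInt) * ((turn r)⁻¹ : GaussianIntˣ) = 1 := Units.mul_inv _
  constructor
  · intro hC
    refine ⟨turn b * ((turn r)⁻¹ : GaussianIntˣ), by linear_combination (turn b : GaussianInt) * huv,
      ?_⟩
    rw [← inLevel_unit_mul n (turn r), Ne, ← Units.mul_right_eq_zero (turn r)]
    have e : (turn r : GaussianInt) * (r - turn b * ((turn r)⁻¹ : GaussianIntˣ) * b) =
        turn r * r - turn b * b := by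
      linear_combination (-(turn b * b : GaussianInt)) * huv
    rw [e]
    exact ⟨hne.1, key.1 hC⟩
  · intro hC
    obtain ⟨hs, hlev⟩ := key.2 hC
    have hss : (s r : GaussianInt) * (s r : GaussianInt) = 1 := by
      have : s r * s r = 1 := by
        unfold s
        rcases lt_trichotomy ((turn r : GaussianInt) * r).im 0 with h | h | h
        · rw [Int.sign_eq_neg_one_of_neg h]; rfl
        · rw [h] at hs; exact absurd rfl hs
        · rw [Int.sign_eq_one_of_pos h]; rfl
      exact_mod_cast congrArg (fun k : ℤ => (k : GaussianInt)) this
    -- The sign is its own inverse, so `s r` stands for the division by `s r`.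
    refine ⟨(s r : GaussianInt) * I * turn b * ((turn r)⁻¹ : GaussianIntˣ), ?_, ?_⟩
    · linear_combination (I * turn b * (s r * s r) : GaussianInt) * huv +
        (I * turn b : GaussianInt) * hss
    rw [← inLevel_unit_mul n (turn r), Ne, ← Units.mul_right_eq_zero (turn r)]
    have e : (turn r : GaussianInt) *
        (r - (s r : GaussianInt) * I * turn b * ((turn r)⁻¹ : GaussianIntˣ) * b) =
        turn r * r - (s r : GaussianInt) * (I * (turn b * b)) := by
      linear_combination (-((s r : GaussianInt) * I * turn b * b : GaussianInt)) * huv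
    rw [e]
    exact ⟨hne.2, hlev⟩

/-! ### Bounds for the Gauss remainder -/

theorem abs_sub_nint_le (x : ℚ) : |x - nint x| ≤ 1 / 2 := by
  unfold nint
  have h1 := Int.floor_le x
  have h2 := Int.lt_floor_add_one x
  have h3 : (⌈x⌉ : ℚ) ≤ ⌊x⌋ + 1 := by exact_mod_cast Int.ceil_le_floor_add_one x
  have h4 := Int.le_ceil x
  split_ifs with h <;> rw [abs_le] <;> constructor <;> linarith

theorem two_mul_abs_sub_nint_mul_le (A : ℤ) {N : ℤ} (hN : 0 < N) :
    2 * |A - nint ((A : ℚ) / (N : ℚ)) * N| ≤ N := by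
  have h := abs_sub_nint_le ((A : ℚ) / (N : ℚ))
  have hN' : (0 : ℚ) < N := by exact_mod_cast hN
  generalize nint ((A : ℚ) / (N : ℚ)) = k at *
  have e : (A : ℚ) / N - k = (A - k * N) / N := by field_simp
  rw [e, abs_div, abs_of_pos hN', div_le_iff₀ hN'] at h
  have : (2 : ℚ) * |(A : ℚ) - k * N| ≤ N := by linarith
  exact_mod_cast this

theorem two_mul_abs_le_of_mul_eq {N p q c d z : ℤ} (hN : 0 < N) (hp : 2 * |p| ≤ N)
    (hq : 2 * |q| ≤ N) (h : N * z = p * c + q * d) : 2 * |z| ≤ |c| + |d| := by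
  refine le_of_mul_le_mul_left ?_ hN
  calc N * (2 * |z|) = 2 * |N * z| := by rw [abs_mul, abs_of_pos hN]; ring
    _ ≤ 2 * (|p| * |c| + |q| * |d|) := by
      rw [h, ← abs_mul, ← abs_mul]
      linarith [abs_add_le (p * c) (q * d)]
    _ = 2 * |p| * |c| + 2 * |q| * |d| := by ring
    _ ≤ N * |c| + N * |d| := by gcongr
    _ = N * (|c| + |d|) := by ring

theorem abs_add_abs_le {x y B : ℤ} (h1 : |x + y| ≤ B) (h2 : |x - y| ≤ B) : |x| + |y| ≤ B := by
  rw [abs_le] at h1 h2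
  rcases abs_cases x with ⟨h, -⟩ | ⟨h, -⟩ <;> rcases abs_cases y with ⟨h', -⟩ | ⟨h', -⟩ <;>
    rw [h, h'] <;> omega

theorem abs_add_add_abs_sub (x y : ℤ) : |x + y| + |x - y| = 2 * max |x| |y| := by
  rcases abs_cases x with ⟨h1, _⟩ | ⟨h1, _⟩ <;> rcases abs_cases y with ⟨h2, _⟩ | ⟨h2, _⟩ <;>
    rcases abs_cases (x + y) with ⟨h3, _⟩ | ⟨h3, _⟩ <;>
    rcases abs_cases (x - y) with ⟨h4, _⟩ | ⟨h4, _⟩ <;> rw [h1, h2, h3, h4] <;> omega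

/-- The remainder is `(p + q i) b` with `|p|, |q| ≤ 1/2`, which bounds each coordinate by `ℓ_1(b) /
2`. The sum and the difference of the coordinates are bounded by `(|X + Y| + |X - Y|) / 2 = ℓ_∞(b)`,
and the larger of their absolute values is `ℓ_1` of the remainder. -/
theorem gaussRemainder_bounds (a : GaussianInt) {b : GaussianInt} (hb : b ≠ 0) :
    2 * lInf (gaussRemainder a b) ≤ lOne b ∧ lOne (gaussRemainder a b) ≤ lInf b := by
  have hN : 0 < Zsqrtd.norm b := GaussianInt.norm_pos.2 hb
  have h1 := two_mul_abs_sub_nint_mul_le (a * star b).re hN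
  have h2 := two_mul_abs_sub_nint_mul_le (a * star b).im hN
  have e : gaussRemainder a b = a - ⟨nint (((a * star b).re : ℚ) / (Zsqrtd.norm b : ℚ)),
    nint (((a * star b).im : ℚ) / (Zsqrtd.norm b : ℚ))⟩ * b := rfl
  rw [e]
  generalize nint (((a * star b).re : ℚ) / (Zsqrtd.norm b : ℚ)) = k at *
  generalize nint (((a * star b).im : ℚ) / (Zsqrtd.norm b : ℚ)) = l at *
  obtain ⟨c, d⟩ := a
  obtain ⟨X, Y⟩ := b
  simp only [lInf, lOne, Zsqrtd.norm_def, Zsqrtd.re_sub, Zsqrtd.im_sub, Zsqrtd.re_mul,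
    Zsqrtd.im_mul, Zsqrtd.re_star, Zsqrtd.im_star] at *
  have a1 := two_mul_abs_le_of_mul_eq (c := X) (d := -Y) (z := c - (k * X + -1 * l * Y)) hN h1 h2
    (by ring)
  have a2 := two_mul_abs_le_of_mul_eq (c := Y) (d := X) (z := d - (k * Y + l * X)) hN h1 h2
    (by ring)
  have a3 := two_mul_abs_le_of_mul_eq (c := X + Y) (d := X - Y)
    (z := c - (k * X + -1 * l * Y) + (d - (k * Y + l * X))) hN h1 h2 (by ring)
  have a4 := two_mul_abs_le_of_mul_eq (c := X - Y) (d := -(X + Y))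
    (z := c - (k * X + -1 * l * Y) - (d - (k * Y + l * X))) hN h1 h2 (by ring)
  rw [abs_neg] at a1 a4
  have a5 := abs_add_add_abs_sub X Y
  exact ⟨by omega, abs_add_abs_le (by omega) (by omega)⟩

/-! ### Levels are closed under divisors -/

theorem le_of_three_mul_two_pow_le {j k : ℕ} (h : 3 * (2 : ℤ) ^ j ≤ 4 * 2 ^ k) : j ≤ k := by
  by_contra! hkj
  have h1 : (2 : ℤ) ^ (k + 1) ≤ 2 ^ j := pow_le_pow_right₀ (by norm_num) hkj
  rw [pow_succ] at h1
  linarith [pow_pos (zero_lt_two' ℤ) k]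

theorem one_le_max_abs {X Y : ℤ} (h : X % 2 = 1 ∨ Y % 2 = 1) : 1 ≤ max |X| |Y| := by
  rcases h with h | h
  · exact le_max_of_le_left (Int.one_le_abs (by omega))
  · exact le_max_of_le_right (Int.one_le_abs (by omega))

/-- The bounds of a level are multiples of the power of two in each of its elements. -/
theorem exists_w_eq_mul {n j : ℕ} (h : 3 * (2 : ℤ) ^ j ≤ w n) : ∃ e : ℕ,
    (w n = 2 ^ j * (3 * 2 ^ e) ∧ w (n + 1) = 2 ^ j * (4 * 2 ^ e)) ∨
    (w n = 2 ^ j * (4 * 2 ^ e) ∧ w (n + 1) = 2 ^ j * (6 * 2 ^ e)) := by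
  obtain ⟨k, ⟨-, h1, h2⟩ | ⟨-, h1, h2⟩⟩ := exists_w n
  · obtain ⟨e, rfl⟩ := Nat.exists_eq_add_of_le (le_of_three_mul_two_pow_le (j := j) (k := k)
      (by linarith [pow_pos (zero_lt_two' ℤ) k]))
    exact ⟨e, Or.inl ⟨by rw [h1, pow_add]; ring, by rw [h2, pow_add]; ring⟩⟩
  · obtain ⟨e, rfl⟩ := Nat.exists_eq_add_of_le (le_of_three_mul_two_pow_le (j := j) (k := k)
      (by linarith))
    exact ⟨e, Or.inr ⟨by rw [h1, pow_add]; ring, by rw [h2, pow_add]; ring⟩⟩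

theorem three_mul_two_pow_le {n j : ℕ} {X Y : ℤ} (hodd : X % 2 = 1 ∨ Y % 2 = 1)
    (h : 2 ^ j * (max |X| |Y| + 2) ≤ w n) : 3 * (2 : ℤ) ^ j ≤ w n := by
  have h1 := one_le_max_abs hodd
  have hpos : (0 : ℤ) < 2 ^ j := by positivity
  nlinarith

theorem max_abs_sub_add (X Y : ℤ) : max |X - Y| |X + Y| = |X| + |Y| := by
  apply le_antisymm
  · exact max_le (abs_sub _ _) (abs_add_le _ _)
  · exact abs_add_abs_le (le_max_right _ _) (le_max_left _ _)

/-- Multiplication by `1 + i` turns `ℓ_1` into `ℓ_∞`, so the `ℓ_∞` bound on the product already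
bounds `ℓ_1(z)`. The power of two stays the same or, if both `X` and `Y` are odd, doubles. -/
theorem InLevel.of_one_add_I_mul {n : ℕ} {z : GaussianInt} (h : InLevel n ((1 + I) * z)) :
    InLevel n z := by
  rcases eq_or_ne z 0 with rfl | hz
  · exact Or.inl rfl
  obtain ⟨j, X, Y, hX, hY, hodd, -⟩ := exists_dyadic hz
  have hVpos : (0 : ℤ) < 2 ^ j := by positivity
  have hre : ((1 + I) * z).re = 2 ^ j * (X - Y) := by simp [I, hX, hY]; ring
  have him : ((1 + I) * z).im = 2 ^ j * (X + Y) := by simp [I, hX, hY]; ring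
  have hmax : max |X| |Y| ≤ |X| + |Y| :=
    max_le (by linarith [abs_nonneg Y]) (by linarith [abs_nonneg X])
  have hmono := w_le_succ n
  rw [inLevel_iff hX hY hodd]
  by_cases hpar : (X - Y) % 2 = 1
  · have hodd' : (X - Y) % 2 = 1 ∨ (X + Y) % 2 = 1 := Or.inl hpar
    rw [inLevel_iff hre him hodd'] at h
    obtain ⟨e, ⟨h1, h2⟩ | ⟨h1, h2⟩⟩ := exists_w_eq_mul (three_mul_two_pow_le hodd' h.1)
    all_goals
      have he : (1 : ℤ) ≤ 2 ^ e := one_le_pow₀ (by norm_num)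
      rw [h1, h2, mul_le_mul_iff_right₀ hVpos, mul_le_mul_iff_right₀ hVpos] at h ⊢
      rw [max_abs_sub_add] at h
      omega
  · obtain ⟨P, hP⟩ : ∃ P, X - Y = 2 * P := ⟨(X - Y) / 2, by omega⟩
    obtain ⟨Q, hQ⟩ : ∃ Q, X + Y = 2 * Q := ⟨(X + Y) / 2, by omega⟩
    have hre' : ((1 + I) * z).re = 2 ^ (j + 1) * P := by rw [hre, hP]; ring
    have him' : ((1 + I) * z).im = 2 ^ (j + 1) * Q := by rw [him, hQ]; ring
    rw [inLevel_iff hre' him' (by omega)] at h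
    have hm := max_abs_sub_add X Y
    rw [hP, hQ, abs_mul, abs_mul, abs_two, ← mul_max_of_nonneg _ _ (by norm_num : (0 : ℤ) ≤ 2)] at hm
    have h1 := h.1
    have e : (2 : ℤ) ^ (j + 1) * (max |P| |Q| + 2) = 2 ^ j * (|X| + |Y| + 4) := by
      rw [← hm]; ring
    rw [e] at h1
    constructor <;> nlinarith

/-- The octagon lies in the disc `L ^ 2 + M ^ 2 ≤ L (L + M) ≤ (W - 2) (W' - 3)`, and the disc of
half that squared radius lies in the octagon again, up to integrality. -/
theorem le_of_norm_bounds {K W W' l m L M : ℤ} (hK : 1 ≤ K)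
    (hW : W = 3 * K ∧ W' = 4 * K ∨ W = 4 * K ∧ W' = 6 * K) (hM : 0 ≤ M)
    (hML : M ≤ L) (h : 2 * (l ^ 2 + m ^ 2) ≤ L ^ 2 + M ^ 2) (h1 : L + 2 ≤ W)
    (h2 : L + M + 3 ≤ W') : l + 2 ≤ W ∧ l + m + 3 ≤ W' := by
  have h3 : L ^ 2 + M ^ 2 ≤ (W - 2) * (W' - 3) := by
    have : L * (L + M) ≤ (W - 2) * (W' - 3) := by
      apply mul_le_mul <;> omega
    nlinarith
  constructor
  · by_contra! hc
    have h4 : (W - 1) ^ 2 ≤ l ^ 2 := by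
      apply pow_le_pow_left₀ <;> omega
    rcases hW with ⟨rfl, rfl⟩ | ⟨rfl, rfl⟩ <;> nlinarith [sq_nonneg m]
  · by_contra! hc
    have h4 : (W' - 2) ^ 2 ≤ (l + m) ^ 2 := by
      apply pow_le_pow_left₀ <;> omega
    have h5 := sq_nonneg (l - m)
    rcases hW with ⟨rfl, rfl⟩ | ⟨rfl, rfl⟩ <;> nlinarith

theorem sq_add_sq_eq (x y : ℤ) : x ^ 2 + y ^ 2 = max |x| |y| ^ 2 + min |x| |y| ^ 2 := by
  rcases le_total |x| |y| with h | h
  · rw [max_eq_right h, min_eq_left h, sq_abs, sq_abs, add_comm]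
  · rw [max_eq_left h, min_eq_right h, sq_abs, sq_abs]

/-- A factor prime to `1 + i` preserves the power of two. Unless it is a unit, it at least doubles
the norm, and `le_of_norm_bounds` applies. -/
theorem InLevel.of_odd_mul {n : ℕ} {q z : GaussianInt} (hq : (q.re + q.im) % 2 = 1)
    (h : InLevel n (q * z)) : InLevel n z := by
  rcases eq_or_ne z 0 with rfl | hz
  · exact Or.inl rfl
  by_cases hu : IsUnit q
  · obtain ⟨u, rfl⟩ := hu
    rwa [inLevel_unit_mul] at h
  have hnorm : 2 ≤ q.re ^ 2 + q.im ^ 2 := by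
    rw [← Zsqrtd.norm_eq_one_iff' (by norm_num), Zsqrtd.norm_def] at hu
    have h0 : q.re ≠ 0 ∨ q.im ≠ 0 := by omega
    have h1 : 0 < q.re ^ 2 + q.im ^ 2 := by
      rcases h0 with h0 | h0 <;> positivity
    by_contra! h2
    apply hu
    linarith [show q.re ^ 2 + q.im ^ 2 = 1 by omega]
  obtain ⟨j, X, Y, hX, hY, hodd, -⟩ := exists_dyadic hz
  obtain ⟨a, b⟩ := q
  simp only at hq hnorm
  have hVpos : (0 : ℤ) < 2 ^ j := by positivity
  have hre : ((⟨a, b⟩ : GaussianInt) * z).re = 2 ^ j * (a * X - b * Y) := by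
    simp [hX, hY]; ring
  have him : ((⟨a, b⟩ : GaussianInt) * z).im = 2 ^ j * (a * Y + b * X) := by
    simp [hX, hY]; ring
  have hodd' : (a * X - b * Y) % 2 = 1 ∨ (a * Y + b * X) % 2 = 1 := by
    rw [Int.sub_emod, Int.add_emod, Int.mul_emod a X, Int.mul_emod b Y, Int.mul_emod a Y,
      Int.mul_emod b X]
    rcases Int.emod_two_eq_zero_or_one a with h1 | h1 <;>
      rcases Int.emod_two_eq_zero_or_one b with h2 | h2 <;>
      rcases Int.emod_two_eq_zero_or_one X with h3 | h3 <;>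
      rcases Int.emod_two_eq_zero_or_one Y with h4 | h4 <;>
      rw [h1, h2, h3, h4] <;> omega
  have hsq : 2 * (X ^ 2 + Y ^ 2) ≤ (a * X - b * Y) ^ 2 + (a * Y + b * X) ^ 2 := by
    have : (a * X - b * Y) ^ 2 + (a * Y + b * X) ^ 2 = (a ^ 2 + b ^ 2) * (X ^ 2 + Y ^ 2) := by ring
    rw [this]
    gcongr
  rw [sq_add_sq_eq, sq_add_sq_eq (a * X - b * Y)] at hsq
  rw [inLevel_iff hre him hodd', ← max_add_min |a * X - b * Y|] at h
  rw [inLevel_iff hX hY hodd, ← max_add_min |X|]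
  have hW : ∃ e : ℕ, ∃ W W' : ℤ, (W = 3 * 2 ^ e ∧ W' = 4 * 2 ^ e ∨ W = 4 * 2 ^ e ∧ W' = 6 * 2 ^ e) ∧
      w n = 2 ^ j * W ∧ w (n + 1) = 2 ^ j * W' := by
    obtain ⟨e, ⟨h1, h2⟩ | ⟨h1, h2⟩⟩ := exists_w_eq_mul (three_mul_two_pow_le hodd' h.1)
    · exact ⟨e, _, _, Or.inl ⟨rfl, rfl⟩, h1, h2⟩
    · exact ⟨e, _, _, Or.inr ⟨rfl, rfl⟩, h1, h2⟩
  obtain ⟨e, W, W', hW, hw, hw'⟩ := hW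
  rw [hw, hw', mul_le_mul_iff_right₀ hVpos, mul_le_mul_iff_right₀ hVpos] at h ⊢
  exact le_of_norm_bounds (one_le_pow₀ (by norm_num)) hW (by positivity)
    min_le_max hsq h.1 h.2

/-- Factors `1 + i` are peeled off `q` until an odd factor remains. -/
theorem InLevel.of_mul {n : ℕ} {q z : GaussianInt} (hq : q ≠ 0) (h : InLevel n (q * z)) :
    InLevel n z := by
  induction hN : q.norm.natAbs using Nat.strong_induction_on generalizing q with
  | _ N ih =>
    by_cases hpar : (q.re + q.im) % 2 = 1
    · exact h.of_odd_mul hpar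
    · obtain ⟨c, hc⟩ : ∃ c, q.re + q.im = 2 * c := ⟨(q.re + q.im) / 2, by omega⟩
      set p : GaussianInt := ⟨c, q.im - c⟩ with hp
      have hqp : q = (1 + I) * p := by
        apply Zsqrtd.ext
        · simp [I, hp]; linarith
        · simp [I, hp]
      have hp0 : p ≠ 0 := by
        rintro h0
        rw [h0, mul_zero] at hqp
        exact hq hqp
      have hnp : 0 < p.norm := GaussianInt.norm_pos.2 hp0
      have hn : q.norm = 2 * p.norm := by
        rw [hqp, Zsqrtd.norm_mul]
        rfl
      rw [hqp, mul_assoc] at h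
      exact ih _ (by omega) hp0 h.of_one_add_I_mul rfl

/-- Some element outside of a level is moved to the next level by every element of the level. -/
theorem exists_not_inLevel (n : ℕ) :
    ∃ c : GaussianInt, ¬ InLevel n c ∧ ∀ r, InLevel n r → InLevel (n + 1) (c - r) := by
  obtain ⟨k, ⟨-, hw, hw'⟩ | ⟨-, hw, hw'⟩⟩ := exists_w n
  · have hKpos : (0 : ℤ) < 2 ^ k := by positivity
    have hre : (⟨2 ^ k, 2 ^ k⟩ : GaussianInt).re = 2 ^ k * 1 := by simp
    have him : (⟨2 ^ k, 2 ^ k⟩ : GaussianInt).im = 2 ^ k * 1 := by simp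
    -- `c = 2 ^ k (1 + i)` fails only the `ℓ_1` bound: `5 * 2 ^ k` exceeds `w (n + 1) = 4 * 2 ^ k`.
    refine ⟨⟨2 ^ k, 2 ^ k⟩, ?_, fun r hr => ?_⟩
    · rw [inLevel_iff hre him (by norm_num), hw']
      norm_num
      intro
      linarith
    rcases eq_or_ne r 0 with rfl | hr0
    · rw [sub_zero, inLevel_iff hre him (by norm_num), hw', w_add_two, hw]
      norm_num
      constructor <;> linarith
    obtain ⟨j, X, Y, hX, hY, hodd, -⟩ := exists_dyadic hr0
    rw [inLevel_iff hX hY hodd] at hr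
    have hVpos : (0 : ℤ) < 2 ^ j := by positivity
    have hjk : j ≤ k := le_of_three_mul_two_pow_le
      ((three_mul_two_pow_le hodd hr.1).trans (by rw [hw]; linarith))
    obtain ⟨e, rfl⟩ := Nat.exists_eq_add_of_le hjk
    have hre' : (⟨2 ^ (j + e), 2 ^ (j + e)⟩ - r).re = 2 ^ j * (2 ^ e - X) := by
      rw [Zsqrtd.re_sub, hX, pow_add]; ring
    have him' : (⟨2 ^ (j + e), 2 ^ (j + e)⟩ - r).im = 2 ^ j * (2 ^ e - Y) := by
      rw [Zsqrtd.im_sub, hY, pow_add]; ring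
    rw [hw, hw', pow_add, mul_left_comm, mul_left_comm 4, mul_le_mul_iff_right₀ hVpos,
      mul_le_mul_iff_right₀ hVpos] at hr
    have hX1 := abs_sub (2 ^ e) X
    have hY1 := abs_sub (2 ^ e) Y
    rw [abs_of_pos (by positivity : (0 : ℤ) < 2 ^ e)] at hX1 hY1
    -- Subtraction from `c` keeps the power of two of `r`. For `e = 0` the `ℓ_1` bound leaves `|X| +
    -- |Y| ≤ 1`, so one part vanishes and its difference from `1` is odd.
    have hodd' : (2 ^ e - X) % 2 = 1 ∨ (2 ^ e - Y) % 2 = 1 := by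
      rcases e with _ | e
      · have h2 := hr.2
        rw [pow_zero] at h2
        rw [pow_zero]
        have := abs_nonneg X
        have := abs_nonneg Y
        have : X = 0 ∨ Y = 0 := by
          rw [← abs_eq_zero (a := X), ← abs_eq_zero (a := Y)]
          omega
        omega
      · rw [pow_succ]
        omega
    rw [inLevel_iff hre' him' hodd', w_add_two, hw, hw', pow_add, mul_left_comm 4,
      mul_left_comm 3, mul_left_comm 2, mul_le_mul_iff_right₀ hVpos, mul_le_mul_iff_right₀ hVpos]
    omega
  · have hKpos : (0 : ℤ) < 2 ^ k := by positivity
    have hre : (⟨2 ^ (k + 1), 0⟩ : GaussianInt).re = 2 ^ (k + 1) * 1 := by simp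
    have him : (⟨2 ^ (k + 1), 0⟩ : GaussianInt).im = 2 ^ (k + 1) * 0 := by simp
    -- `c = 2 ^ (k + 1)` fails the `ℓ_∞` bound: `6 * 2 ^ k` exceeds `w n = 4 * 2 ^ k`.
    refine ⟨⟨2 ^ (k + 1), 0⟩, ?_, fun r hr => ?_⟩
    · rw [inLevel_iff hre him (by norm_num), hw, pow_succ]
      norm_num
      intro
      linarith
    rcases eq_or_ne r 0 with rfl | hr0
    · rw [sub_zero, inLevel_iff hre him (by norm_num), hw', w_add_two, hw, pow_succ]
      norm_num
      constructor <;> linarith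
    obtain ⟨j, X, Y, hX, hY, hodd, -⟩ := exists_dyadic hr0
    rw [inLevel_iff hX hY hodd] at hr
    have hVpos : (0 : ℤ) < 2 ^ j := by positivity
    have hjk : j ≤ k := le_of_three_mul_two_pow_le
      ((three_mul_two_pow_le hodd hr.1).trans hw.le)
    obtain ⟨e, rfl⟩ := Nat.exists_eq_add_of_le hjk
    have hre' : (⟨2 ^ (j + e + 1), 0⟩ - r).re = 2 ^ j * (2 * 2 ^ e - X) := by
      rw [Zsqrtd.re_sub, hX, pow_succ, pow_add]; ring
    have him' : (⟨2 ^ (j + e + 1), 0⟩ - r).im = 2 ^ j * (-Y) := by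
      rw [Zsqrtd.im_sub, hY]; ring
    rw [hw, hw', pow_add, mul_left_comm, mul_left_comm 6, mul_le_mul_iff_right₀ hVpos,
      mul_le_mul_iff_right₀ hVpos] at hr
    have hX1 := abs_sub (2 * 2 ^ e) X
    rw [abs_of_pos (by positivity : (0 : ℤ) < 2 * 2 ^ e)] at hX1
    have he : (0 : ℤ) < 2 ^ e := by positivity
    rw [inLevel_iff hre' him' (by omega), w_add_two, hw, hw', pow_add, mul_left_comm 6,
      mul_left_comm 4, mul_left_comm 2, mul_le_mul_iff_right₀ hVpos, mul_le_mul_iff_right₀ hVpos,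
      abs_neg]
    omega

/-! ### The levels describe the minimal Euclidean function -/

/-- The least level of an element. -/
noncomputable def level (z : GaussianInt) : ℕ := sInf {n | InLevel n z}

theorem level_le_iff {z : GaussianInt} {n : ℕ} : level z ≤ n ↔ InLevel n z :=
  ⟨fun h => InLevel.mono h (Nat.sInf_mem (exists_inLevel z)), fun h => Nat.sInf_le h⟩

/-- Level `0` forces `ℓ_1(b) ≤ 1`, and then `2 ℓ_∞(r) ≤ 1`. -/
theorem gaussRemainder_eq_zero_of_inLevel_zero (a : GaussianInt) {b : GaussianInt} (hb : b ≠ 0)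
    (h : InLevel 0 b) : gaussRemainder a b = 0 := by
  by_contra hr
  have h1 := (gaussRemainder_bounds a hb).1
  have h2 := lInf_pos hr
  have h3 : (0 : ℤ) < 2 ^ v2 b := by positivity
  have h4 := (h.resolve_left hb).2
  rw [show w (0 + 1) = 4 from rfl] at h4
  omega

theorem isEuclideanFunction_level :
    IsEuclideanFunction (fun z : GaussianInt => (level z : Ordinal.{0})) := by
  intro a b _ hb
  simp only [Nat.cast_lt]
  by_cases hr : gaussRemainder a b = 0
  · exact ⟨gaussQuotient a b, 0,
      by rw [gaussRemainder] at hr; linear_combination hr, Or.inl rfl⟩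
  have hbl : InLevel (level b) b := level_le_iff.1 le_rfl
  rcases hn : level b with _ | n
  · rw [hn] at hbl
    exact absurd (gaussRemainder_eq_zero_of_inLevel_zero a hb hbl) hr
  · rw [hn] at hbl
    by_cases hrn : InLevel n (gaussRemainder a b)
    · exact ⟨gaussQuotient a b, gaussRemainder a b, by rw [gaussRemainder]; ring,
        Or.inr (Nat.lt_succ_of_le (level_le_iff.2 hrn))⟩
    obtain ⟨h1, h2⟩ := gaussRemainder_bounds a hb
    have key := exists_correction hb hr h1 h2 hbl hrn
    obtain ⟨c, hc⟩ : ∃ c, InLevel n (gaussRemainder a b - c * b) := by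
      by_cases hk : KeepsDirection n (turn b * b) (turn (gaussRemainder a b) * gaussRemainder a b)
      · obtain ⟨c, -, -, hc⟩ := key.1 hk
        exact ⟨c, hc⟩
      · obtain ⟨c, -, -, hc⟩ := key.2 hk
        exact ⟨c, hc⟩
    exact ⟨gaussQuotient a b + c, gaussRemainder a b - c * b, by rw [gaussRemainder]; ring,
      Or.inr (Nat.lt_succ_of_le (level_le_iff.2 hc))⟩

theorem inLevel_of_le {f : GaussianInt → Ordinal.{0}} (hf : IsEuclideanFunction f)
    (n : ℕ) {z : GaussianInt} (hz : z ≠ 0) (h : f z ≤ n) : InLevel n z := by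
  induction n generalizing z with
  | zero =>
    -- No value lies below `0`, so `z` divides `1`, which is in level `0`.
    obtain ⟨q, r, hqr, hr⟩ := hf 1 z one_ne_zero hz
    have hr0 : r = 0 := by
      refine hr.resolve_right fun hlt => ?_
      rw [Nat.cast_zero] at h
      exact absurd (hlt.trans_le h) not_lt_zero
    rw [hr0, add_zero] at hqr
    have hq : q ≠ 0 := by
      rintro rfl
      simp at hqr
    apply InLevel.of_mul hq
    rw [← hqr, inLevel_iff (j := 0) (X := 1) (Y := 0) rfl rfl (by norm_num)]
    decide
  | succ n ih =>
    obtain ⟨c, hc, hcr⟩ := exists_not_inLevel n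
    have hc0 : c ≠ 0 := fun h0 => hc (Or.inl h0)
    obtain ⟨q, r, hqr, hr⟩ := hf c z hc0 hz
    have hrn : InLevel n r := by
      by_cases hr0 : r = 0
      · exact Or.inl hr0
      · refine ih hr0 ?_
        have := (hr.resolve_left hr0).trans_le h
        rwa [Nat.cast_succ, Order.lt_add_one_iff] at this
    have hq : q ≠ 0 := by
      rintro rfl
      rw [zero_mul, zero_add] at hqr
      exact hc (hqr ▸ hrn)
    apply InLevel.of_mul hq
    rw [show q * z = c - r by rw [hqr]; ring]
    exact hcr r hrn

theorem minEuclid_le_iff {z : GaussianInt} (hz : z ≠ 0) (n : ℕ) :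
    minEuclid z ≤ (n : Ordinal.{0}) ↔ InLevel n z := by
  constructor
  · intro h
    -- The infimum at `z` is attained by some Euclidean function, since ordinals are well-ordered
    -- and `level` provides a candidate.
    obtain ⟨f, hf, hfz⟩ := csInf_mem (s := {α : Ordinal.{0} | ∃ f : GaussianInt → Ordinal.{0},
      IsEuclideanFunction f ∧ f z = α}) ⟨_, _, isEuclideanFunction_level, rfl⟩
    exact inLevel_of_le hf n hz (hfz.trans_le h)
  · intro h
    have h1 : minEuclid z ≤ (level z : Ordinal.{0}) := csInf_le' ⟨_, isEuclideanFunction_level, rfl⟩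
    exact h1.trans (Nat.cast_le.2 (level_le_iff.2 h))

theorem keepsDirection_turn_iff (n : ℕ) {b r : GaussianInt} (hb : b ≠ 0) (hr : r ≠ 0) :
    KeepsDirection n (turn b * b) (turn r * r) ↔
      0 ≤ ((turn b : GaussianInt) * b).im * ((turn r : GaussianInt) * r).im ∨
      m r + m b ≤ lInf r ∨
      (m b < lInf r ∧ lInf r < m b + m r ∧ w n - 2 ^ (v2 b + 1) < lInf b - m r) := by
  rw [KeepsDirection, abs_turn_mul_im hb, abs_turn_mul_im hr, turn_mul_re hb, turn_mul_re hr,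
    v2_unit_mul]

end GaussDiv

theorem theorem2 (a b q r : GaussianInt) (n : ℕ) (ha : a ≠ 0) (hb : b ≠ 0)
    (hq : q = GaussDiv.gaussQuotient a b) (hr : r = GaussDiv.gaussRemainder a b) (hr0 : r ≠ 0)
    (hrb : minEuclid b ≤ minEuclid r) (hn : minEuclid b = (n : Ordinal.{0})) :
    let ub : GaussianIntˣ := GaussDiv.turn b
    let ur : GaussianIntˣ := GaussDiv.turn r
    let C1 : Prop := 0 ≤ ((ub : GaussianInt) * b).im * ((ur : GaussianInt) * r).im
    let C2 : Prop := GaussDiv.m r + GaussDiv.m b ≤ GaussDiv.lInf r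
    let C3 : Prop :=
      GaussDiv.m b < GaussDiv.lInf r ∧ GaussDiv.lInf r < GaussDiv.m b + GaussDiv.m r ∧
        GaussDiv.w (n - 1) - 2 ^ (GaussDiv.v2 b + 1) < GaussDiv.lInf b - GaussDiv.m r
    (C1 ∨ C2 ∨ C3 →
      ∃ c : GaussianInt, c * (ur : GaussianInt) = (ub : GaussianInt) ∧
        a = (q + c) * b + (r - c * b) ∧
        r - c * b ≠ 0 ∧ minEuclid (r - c * b) < minEuclid b) ∧
    (¬ (C1 ∨ C2 ∨ C3) →
      ∃ c : GaussianInt,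
        c * ((GaussDiv.s r : GaussianInt) * (ur : GaussianInt)) = GaussDiv.I * (ub : GaussianInt) ∧
        a = (q + c) * b + (r - c * b) ∧
        r - c * b ≠ 0 ∧ minEuclid (r - c * b) < minEuclid b) := by
  intro ub ur C1 C2 C3
  have hqr : q * b + r = a := by rw [hq, hr, GaussDiv.gaussRemainder]; ring
  obtain ⟨h1, h2⟩ := GaussDiv.gaussRemainder_bounds a hb
  rw [← hr] at h1 h2
  have hbn : GaussDiv.InLevel n b := (GaussDiv.minEuclid_le_iff hb n).1 hn.le
  -- For `n = 0` the Gauss remainder would vanish; so `n ≥ 1`, and the subtraction in `w (n - 1)` is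
  -- a true one.
  rcases n with _ | n
  · exact absurd (hr.trans (GaussDiv.gaussRemainder_eq_zero_of_inLevel_zero a hb hbn)) hr0
  have hlt : ∀ x : Ordinal.{0}, x < minEuclid b ↔ x ≤ n := fun x => by
    rw [hn, Nat.cast_succ, Order.lt_add_one_iff]
  have hrn : ¬ GaussDiv.InLevel n r := by
    rw [← GaussDiv.minEuclid_le_iff hr0, ← hlt]
    exact not_lt.2 hrb
  obtain ⟨k1, k2⟩ := GaussDiv.exists_correction hb hr0 h1 h2 hbn hrn
  rw [GaussDiv.keepsDirection_turn_iff n hb hr0] at k1 k2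
  constructor
  · intro hC
    obtain ⟨c, hc, hne, hlev⟩ := k1 hC
    exact ⟨c, hc, by rw [← hqr]; ring, hne, (hlt _).2 ((GaussDiv.minEuclid_le_iff hne n).2 hlev)⟩
  · intro hC
    obtain ⟨c, hc, hne, hlev⟩ := k2 hC
    exact ⟨c, hc, by rw [← hqr]; ring, hne, (hlt _).2 ((GaussDiv.minEuclid_le_iff hne n).2 hlev)⟩
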